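/- Let $d\ge 0$ be an integer and $p\in[1,\infty)$ a real number. Write points of $\mathbb{R}^{d+1}$ as $(x,t)$ with $x\in\mathbb{R}^d$ and $t\in\mathbb{R}$, let $\|\cdot\|_p$ denote the $\ell^p$ norm, and let $P_p(\mathbb{R}^{d+1})$ be the set of Borel probability measures $\mu$ on $\mathbb{R}^{d+1}$ with $\int \|z_0-z\|_p^p\,d\mu(z)<\infty$ for every (equivalently, some) $z_0\in\mathbb{R}^{d+1}$. For $\alpha,\beta\in P_p(\mathbb{R}^{d+1})$ let $\Pi(\alpha,\beta)$ be the set of Borel probability measures on $\mathbb{R}^{d+1}\times\mathbb{R}^{d+1}$ with first marginal $\alpha$ and second marginal $\beta$. For $w\in[0,1]$ put $$d_{p,w}\big((x,t),(y,s)\big)=\big(w\|x-y\|_p^p+(1-w)|t-s|^p\big)^{1/p},$$ and define the time-integrated optimal transport distance $$\mathcal{D}_p(\alpha,\beta)=\sup_{w\in[0,1]}\left[\inf_{\pi\in\Pi(\alpha,\beta)}\int d_{p,w}(z,z')^p\,d\pi(z,z')\right]^{1/p}.$$ Then $\mathcal{D}_p$ is finite on $P_p(\mathbb{R}^{d+1})$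 and is a metric on it, and the metric space $(P_p(\mathbb{R}^{d+1}),\mathcal{D}_p)$ is complete and separable. -/

import Mathlib

open MeasureTheory

namespace TiOT

/-- The `ℓ^p` distance `‖z - z'‖_p` on `ℝⁿ`. -/
noncomputable def lpDist (p : ℝ) {n : ℕ} (z z' : Fin n → ℝ) : ℝ :=
  (∑ i, |z i - z' i| ^ p) ^ (1 / p)

/-- The feature part `x ∈ ℝ^d` of a point `(x, t) ∈ ℝ^{d+1}`. -/
def feature {d : ℕ} (z : Fin (d + 1) → ℝ) : Fin d → ℝ := fun i => z i.castSucc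

/-- The time part `t`, i.e. the last coordinate, of a point `(x, t) ∈ ℝ^{d+1}`. -/
def time {d : ℕ} (z : Fin (d + 1) → ℝ) : ℝ := z (Fin.last d)

/-- `d_{p,w}((x,t),(y,s)) = (w ‖x - y‖_p^p + (1 - w) |t - s|^p)^{1/p}`. -/
noncomputable def weightedDist (p w : ℝ) {d : ℕ} (z z' : Fin (d + 1) → ℝ) : ℝ :=
  (w * lpDist p (feature z) (feature z') ^ p + (1 - w) * |time z - time z'| ^ p) ^ (1 / p)

/-- `P_p(ℝ^{d+1})`: Borel probability measures on `ℝ^{d+1}` with finite `p`-th moment. -/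
def Pp (d : ℕ) (p : ℝ) : Type :=
  {μ : ProbabilityMeasure (Fin (d + 1) → ℝ) //
    ∀ z₀ : Fin (d + 1) → ℝ,
      ∫⁻ z, ENNReal.ofReal (lpDist p z₀ z ^ p) ∂(μ : Measure (Fin (d + 1) → ℝ)) < ⊤}

/-- `Π(α, β)`: probability measures on the product with marginals `α` and `β`. -/
def couplings {d : ℕ} (α β : ProbabilityMeasure (Fin (d + 1) → ℝ)) :
    Set (ProbabilityMeasure ((Fin (d + 1) → ℝ) × (Fin (d + 1) → ℝ))) :=
  {π | (π : Measure ((Fin (d + 1) → ℝ) × (Fin (d + 1) → ℝ))).map Prod.fst = α ∧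
    (π : Measure ((Fin (d + 1) → ℝ) × (Fin (d + 1) → ℝ))).map Prod.snd = β}

/-- `𝒲_{p,w}(α, β)`, the `p`-Wasserstein distance for the pseudometric `d_{p,w}`,
with values in `[0, ∞]`. -/
noncomputable def wasserstein (p w : ℝ) {d : ℕ} (α β : Pp d p) : ENNReal :=
  (⨅ π ∈ couplings α.1 β.1,
    ∫⁻ q, ENNReal.ofReal (weightedDist p w q.1 q.2 ^ p)
      ∂(π : Measure ((Fin (d + 1) → ℝ) × (Fin (d + 1) → ℝ)))) ^ (1 / p)

/-- The time-integrated optimal transport distance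
`𝒟_p(α, β) = sup_{w ∈ [0,1]} 𝒲_{p,w}(α, β)`, with values in `[0, ∞]`. -/
noncomputable def tiotDist {d : ℕ} {p : ℝ} (α β : Pp d p) : ENNReal :=
  ⨆ w ∈ Set.Icc (0 : ℝ) 1, wasserstein p w α β

end TiOT

/-!
The distance `𝒟_p` is Lipschitz equivalent to the classical Wasserstein distance `W_p` for the sup
norm of `ℝ^{d+1}`. On the one hand `d_{p,w}` is at most the `ℓ^p` distance for every `w`, hence at
most `(d+1)^{1/p}` times the sup distance; on the other hand `2^{1/p} d_{p,1/2}` is the `ℓ^p`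
distance, which dominates the sup distance. Finiteness, separation, completeness and separability
thus pass from `W_p` to `𝒟_p`, while the triangle inequality holds for each `w` by gluing couplings.

For a separable Banach space `E`, taking laws is a `1`-Lipschitz map from the random vectors
`L^q(Ω; E)` to the Wasserstein space. It is onto for `Ω = [0,1]`, and `L^q([0,1]; E)` is separable.
Given a fast Cauchy sequence of laws, gluing near-optimal couplings of consecutive terms realises
it as the laws of a fast Cauchy sequence in `L^q(Ω; E)` for a single `Ω`; that sequence converges,
hence so do the laws. Separation follows from Markov's inequality, which bounds the square of the
Lévy–Prokhorov distance by the Wasserstein distance.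
-/

namespace TiOT

open ProbabilityTheory
open scoped ENNReal NNReal

section Gluing

theorem map_compProd_comap {A B C : Type*} [MeasurableSpace A] [MeasurableSpace B]
    [MeasurableSpace C] (ρ : Measure A) [SFinite ρ] (η : Kernel B C) [IsSFiniteKernel η]
    {g : A → B} (hg : Measurable g) :
    (ρ ⊗ₘ η.comap g hg).map (Prod.map g id) = ρ.map g ⊗ₘ η := by
  ext s hs
  have hg_id : Measurable (Prod.map g (id : C → C)) := hg.prodMap measurable_id
  rw [Measure.map_apply hg_id hs, Measure.compProd_apply (hg_id hs), Measure.compProd_apply hs,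
    lintegral_map (Kernel.measurable_kernel_prodMk_left hs) hg]
  rfl

theorem exists_measure_glue {A B C : Type*} [MeasurableSpace A] [MeasurableSpace B]
    [MeasurableSpace C] [StandardBorelSpace C] [Nonempty C]
    (π₁ : Measure (A × B)) [SFinite π₁] (π₂ : Measure (B × C)) [IsFiniteMeasure π₂]
    (h : π₁.snd = π₂.fst) :
    ∃ P : Measure ((A × B) × C), P.fst = π₁ ∧ P.map (fun x => (x.1.2, x.2)) = π₂ := by
  refine ⟨π₁ ⊗ₘ π₂.condKernel.comap Prod.snd measurable_snd, Measure.fst_compProd _ _, ?_⟩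
  calc (π₁ ⊗ₘ π₂.condKernel.comap Prod.snd measurable_snd).map (Prod.map Prod.snd id)
      = π₁.snd ⊗ₘ π₂.condKernel := map_compProd_comap π₁ π₂.condKernel measurable_snd
    _ = π₂ := by rw [h, π₂.disintegrate π₂.condKernel]

theorem map_eval_zero_trajMeasure {X : ℕ → Type*} [∀ n, MeasurableSpace (X n)]
    (μ : Measure (X 0)) (κ : (n : ℕ) → Kernel (Π i : Finset.Iic n, X i) (X (n + 1)))
    [∀ n, IsMarkovKernel (κ n)] :
    (Kernel.trajMeasure μ κ).map (fun x => x 0) = μ := by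
  let eval : (Π i : Finset.Iic 0, X i) ≃ᵐ X 0 := MeasurableEquiv.piUnique _
  have h_restrict : (Kernel.trajMeasure μ κ).map (Preorder.frestrictLe 0) = μ.map eval.symm := by
    rw [Kernel.trajMeasure, Measure.map_comp _ _ (by fun_prop), Kernel.traj_map_frestrictLe,
      Kernel.partialTraj_self, Measure.id_comp]
    rfl
  calc (Kernel.trajMeasure μ κ).map (fun x => x 0)
      = ((Kernel.trajMeasure μ κ).map (Preorder.frestrictLe 0)).map eval :=
        (Measure.map_map eval.measurable (Preorder.measurable_frestrictLe 0)).symm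
    _ = μ := by rw [h_restrict, eval.map_map_symm]

theorem exists_measure_glue_seq {X : ℕ → Type*} [∀ n, MeasurableSpace (X n)]
    [∀ n, StandardBorelSpace (X n)] [∀ n, Nonempty (X n)]
    (π : ∀ n, Measure (X n × X (n + 1))) [∀ n, IsProbabilityMeasure (π n)]
    (h : ∀ n, (π n).snd = (π (n + 1)).fst) :
    ∃ P : Measure (∀ n, X n), IsProbabilityMeasure P ∧
      ∀ n, P.map (fun x => (x n, x (n + 1))) = π n := by
  let last (n : ℕ) : (Π i : Finset.Iic n, X i) → X n := fun x => x ⟨n, by simp⟩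
  have h_last (n : ℕ) : Measurable (last n) := by fun_prop
  let κ (n : ℕ) : Kernel (Π i : Finset.Iic n, X i) (X (n + 1)) :=
    (π n).condKernel.comap (last n) (h_last n)
  let P : Measure (∀ n, X n) := Kernel.trajMeasure (π 0).fst κ
  have h_step (n : ℕ) :
      P.map (fun x => (x n, x (n + 1))) = P.map (fun x => x n) ⊗ₘ (π n).condKernel := by
    calc P.map (fun x => (x n, x (n + 1)))
        = (P.map (fun x => (Preorder.frestrictLe n x, x (n + 1)))).map (Prod.map (last n) id) := by
          rw [Measure.map_map (by fun_prop) (by fun_prop)]; rfl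
      _ = (P.map (Preorder.frestrictLe n)).map (last n) ⊗ₘ (π n).condKernel := by
          rw [← Kernel.map_frestrictLe_trajMeasure_compProd_eq_map_trajMeasure,
            map_compProd_comap]
      _ = P.map (fun x => x n) ⊗ₘ (π n).condKernel := by
          rw [Measure.map_map (h_last n) (by fun_prop)]; rfl
  have h_law (n : ℕ) : P.map (fun x => x n) = (π n).fst := by
    induction n with
    | zero => exact map_eval_zero_trajMeasure _ _
    | succ n ih =>
      calc P.map (fun x => x (n + 1)) = (P.map (fun x => (x n, x (n + 1)))).snd := by
            rw [Measure.snd, Measure.map_map (by fun_prop) (by fun_prop)]; rfl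
        _ = (π (n + 1)).fst := by rw [h_step, ih, (π n).disintegrate, h]
  exact ⟨P, inferInstance, fun n => by rw [h_step, h_law, (π n).disintegrate]⟩

end Gluing

section Transport

variable {E F G : Type*} [MeasurableSpace E] [MeasurableSpace F] [MeasurableSpace G]

/-- `π` is a coupling (a transport plan) of `μ` and `ν`: its marginals are `μ` and `ν`. -/
structure IsCoupling (π : Measure (E × F)) (μ : Measure E) (ν : Measure F) : Prop where
  fst_eq : π.fst = μ
  snd_eq : π.snd = ν

/-- The `L^q` optimal transport distance for the cost `c`: the infimum over all couplings of the
`L^q` norm of `c` (and not of its `q`-th power), so that `q = ∞` is allowed and the triangle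
inequality passes from `c` to the distance. -/
noncomputable def transportDist (c : E → F → ℝ≥0∞) (q : ℝ≥0∞) (μ : Measure E) (ν : Measure F) :
    ℝ≥0∞ :=
  ⨅ (π : Measure (E × F)) (_ : IsCoupling π μ ν), eLpNorm (fun z => c z.1 z.2) q π

variable {π : Measure (E × F)} {μ : Measure E} {ν : Measure F} {c : E → F → ℝ≥0∞} {q : ℝ≥0∞}

theorem IsCoupling.isProbabilityMeasure (h : IsCoupling π μ ν) [IsProbabilityMeasure μ] :
    IsProbabilityMeasure π :=
  have : IsProbabilityMeasure (π.map Prod.fst) := by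
    rw [← Measure.fst, h.fst_eq]; infer_instance
  Measure.isProbabilityMeasure_of_map Prod.fst

theorem IsCoupling.isFiniteMeasure (h : IsCoupling π μ ν) [IsFiniteMeasure μ] :
    IsFiniteMeasure π :=
  have : IsFiniteMeasure (π.map Prod.fst) := by rw [← Measure.fst, h.fst_eq]; infer_instance
  Measure.isFiniteMeasure_of_map measurable_fst.aemeasurable

theorem isCoupling_map_prodMk {Ω : Type*} [MeasurableSpace Ω] {P : Measure Ω} {X : Ω → E}
    {Y : Ω → F} (hX : AEMeasurable X P) (hY : AEMeasurable Y P) :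
    IsCoupling (P.map fun ω => (X ω, Y ω)) (P.map X) (P.map Y) :=
  ⟨Measure.fst_map_prodMk₀ hY, Measure.snd_map_prodMk₀ hX⟩

theorem IsCoupling.swap (h : IsCoupling π μ ν) : IsCoupling (π.map Prod.swap) ν μ :=
  ⟨by rw [Measure.fst_map_swap, h.snd_eq], by rw [Measure.snd_map_swap, h.fst_eq]⟩

theorem isCoupling_prod (μ : Measure E) (ν : Measure F) [IsProbabilityMeasure μ]
    [IsProbabilityMeasure ν] : IsCoupling (μ.prod ν) μ ν :=
  ⟨Measure.fst_prod, Measure.snd_prod⟩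

theorem transportDist_le_eLpNorm (h : IsCoupling π μ ν) :
    transportDist c q μ ν ≤ eLpNorm (fun z => c z.1 z.2) q π :=
  iInf₂_le π h

theorem exists_isCoupling_of_transportDist_lt {r : ℝ≥0∞} (h : transportDist c q μ ν < r) :
    ∃ π, IsCoupling π μ ν ∧ eLpNorm (fun z => c z.1 z.2) q π < r := by
  simpa only [transportDist, iInf_lt_iff, exists_prop] using h

theorem transportDist_map_le (hc : Measurable fun z : E × F => c z.1 z.2)
    {Ω : Type*} [MeasurableSpace Ω] {P : Measure Ω} {X : Ω → E} {Y : Ω → F}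
    (hX : AEMeasurable X P) (hY : AEMeasurable Y P) :
    transportDist c q (P.map X) (P.map Y) ≤ eLpNorm (fun ω => c (X ω) (Y ω)) q P :=
  (transportDist_le_eLpNorm (isCoupling_map_prodMk hX hY)).trans_eq
    (eLpNorm_map_measure hc.aestronglyMeasurable (hX.prodMk hY))

theorem transportDist_self {c : E → E → ℝ≥0∞} (hc : Measurable fun z : E × E => c z.1 z.2)
    (h_self : ∀ x, c x x = 0) (μ : Measure E) : transportDist c q μ μ = 0 := by
  have h := transportDist_map_le (P := μ) (q := q) hc aemeasurable_id aemeasurable_id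
  simpa only [Measure.map_id, id_eq, h_self, eLpNorm_zero', nonpos_iff_eq_zero] using h

theorem transportDist_swap_le (hc : Measurable fun z : E × F => c z.1 z.2) :
    transportDist (fun y x => c x y) q ν μ ≤ transportDist c q μ ν := by
  refine le_iInf₂ fun π hπ => (transportDist_le_eLpNorm hπ.swap).trans_eq ?_
  exact eLpNorm_map_measure (hc.comp measurable_swap).aestronglyMeasurable
    measurable_swap.aemeasurable

theorem transportDist_comm {c : E → E → ℝ≥0∞} (hc : Measurable fun z : E × E => c z.1 z.2)
    (h_comm : ∀ x y, c x y = c y x) (μ ν : Measure E) :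
    transportDist c q μ ν = transportDist c q ν μ := by
  have h_swap : (fun y x => c x y) = c := funext₂ fun y x => h_comm x y
  have h_le (μ ν : Measure E) : transportDist c q μ ν ≤ transportDist c q ν μ := by
    simpa only [h_swap] using transportDist_swap_le (q := q) (μ := ν) (ν := μ) hc
  exact (h_le μ ν).antisymm (h_le ν μ)

theorem transportDist_triangle [StandardBorelSpace G] [Nonempty G] {c₁ : E → F → ℝ≥0∞}
    {c₂ : F → G → ℝ≥0∞} {c₃ : E → G → ℝ≥0∞} (hc₁ : Measurable fun z : E × F => c₁ z.1 z.2)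
    (hc₂ : Measurable fun z : F × G => c₂ z.1 z.2) (hc₃ : Measurable fun z : E × G => c₃ z.1 z.2)
    (h_tri : ∀ x y z, c₃ x z ≤ c₁ x y + c₂ y z) (hq : 1 ≤ q)
    (μ : Measure E) (ν : Measure F) (τ : Measure G) [IsFiniteMeasure μ] [IsFiniteMeasure ν] :
    transportDist c₃ q μ τ ≤ transportDist c₁ q μ ν + transportDist c₂ q ν τ := by
  simp only [transportDist, ENNReal.iInf_add, ENNReal.add_iInf]
  refine le_iInf₂ fun π₂ h₂ => le_iInf₂ fun π₁ h₁ => ?_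
  have := h₁.isFiniteMeasure
  have := h₂.isFiniteMeasure
  obtain ⟨P, hP₁, hP₂⟩ := exists_measure_glue π₁ π₂ (h₁.snd_eq.trans h₂.fst_eq.symm)
  have h_fst : P.map (fun x => x.1.1) = μ := by
    rw [← h₁.fst_eq, ← hP₁, Measure.fst, Measure.fst,
      Measure.map_map measurable_fst measurable_fst]
    rfl
  have h_snd : P.map (fun x => x.2) = τ := by
    rw [← h₂.snd_eq, ← hP₂, Measure.snd, Measure.map_map measurable_snd (by fun_prop)]
    rfl
  calc ⨅ (π) (_ : IsCoupling π μ τ), eLpNorm (fun z => c₃ z.1 z.2) q π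
      ≤ eLpNorm (fun x : (E × F) × G => c₃ x.1.1 x.2) q P := by
        rw [← h_fst, ← h_snd]
        exact transportDist_map_le hc₃ (by fun_prop) (by fun_prop)
    _ ≤ eLpNorm ((fun x => c₁ x.1.1 x.1.2) + fun x => c₂ x.1.2 x.2) q P :=
        eLpNorm_mono_enorm fun x => h_tri _ _ _
    _ ≤ eLpNorm (fun x => c₁ x.1.1 x.1.2) q P + eLpNorm (fun x => c₂ x.1.2 x.2) q P :=
        eLpNorm_add_le (hc₁.comp measurable_fst).aestronglyMeasurable
          (hc₂.comp (by fun_prop : Measurable fun x : (E × F) × G => (x.1.2, x.2))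
            ).aestronglyMeasurable hq
    _ = eLpNorm (fun z => c₁ z.1 z.2) q π₁ + eLpNorm (fun z => c₂ z.1 z.2) q π₂ := by
        rw [← hP₁, ← hP₂, Measure.fst,
          eLpNorm_map_measure hc₁.aestronglyMeasurable (by fun_prop),
          eLpNorm_map_measure hc₂.aestronglyMeasurable (by fun_prop)]
        rfl

theorem transportDist_le_mul {c' : E → F → ℝ≥0∞} {K : ℝ≥0} (hK : K ≠ 0)
    (h : ∀ x y, c x y ≤ K * c' x y) (μ : Measure E) (ν : Measure F) :
    transportDist c q μ ν ≤ K * transportDist c' q μ ν := by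
  simp only [transportDist, ENNReal.mul_iInf_of_ne (ENNReal.coe_ne_zero.2 hK) ENNReal.coe_ne_top]
  exact iInf₂_mono fun π _ =>
    eLpNorm_le_mul_eLpNorm_of_ae_le_mul' (ae_of_all _ fun z => h z.1 z.2) q

end Transport

section LevyProkhorov

variable {E : Type*} [MeasurableSpace E] {q : ℝ≥0∞}

theorem levyProkhorovEDist_le_of_isCoupling [PseudoEMetricSpace E] [OpensMeasurableSpace E]
    {μ ν : Measure E} [IsProbabilityMeasure μ] [IsProbabilityMeasure ν] {π : Measure (E × E)}
    (hπ : IsCoupling π μ ν) {δ : ℝ≥0∞} (h : π {z | δ ≤ edist z.1 z.2} ≤ δ) :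
    levyProkhorovEDist μ ν ≤ δ := by
  refine levyProkhorovEDist_le_of_forall_le μ ν δ fun ε B hε hε_top hB => ?_
  have h_subset : Prod.fst ⁻¹' B ⊆
      Prod.snd ⁻¹' Metric.thickening ε.toReal B ∪ {z : E × E | δ ≤ edist z.1 z.2} := by
    intro z hz
    by_cases hz_far : δ ≤ edist z.1 z.2
    · exact Or.inr hz_far
    refine Or.inl (Metric.mem_thickening_iff_infEDist_lt.2 ?_)
    rw [ENNReal.ofReal_toReal hε_top.ne]
    calc Metric.infEDist z.2 B ≤ edist z.2 z.1 := Metric.infEDist_le_edist_of_mem hz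
      _ = edist z.1 z.2 := edist_comm _ _
      _ < ε := (not_le.1 hz_far).trans hε
  calc μ B = π (Prod.fst ⁻¹' B) := by rw [← hπ.fst_eq, Measure.fst_apply hB]
    _ ≤ π (Prod.snd ⁻¹' Metric.thickening ε.toReal B) + π {z | δ ≤ edist z.1 z.2} :=
        (measure_mono h_subset).trans (measure_union_le _ _)
    _ ≤ ν (Metric.thickening ε.toReal B) + ε := by
        rw [← hπ.snd_eq, Measure.snd_apply Metric.isOpen_thickening.measurableSet]
        gcongr
        exact h.trans hε.le

theorem levyProkhorovEDist_sq_le_transportDist [PseudoEMetricSpace E] [OpensMeasurableSpace E]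
    [SecondCountableTopology E] (hq : 1 ≤ q) (μ ν : Measure E) [IsProbabilityMeasure μ]
    [IsProbabilityMeasure ν] :
    levyProkhorovEDist μ ν ^ 2 ≤ transportDist edist q μ ν := by
  refine le_of_forall_gt_imp_ge_of_dense fun r hr => ?_
  obtain ⟨π, hπ, hπr⟩ := exists_isCoupling_of_transportDist_lt hr
  have := hπ.isProbabilityMeasure
  obtain ⟨δ, rfl⟩ : ∃ δ : ℝ≥0∞, δ ^ 2 = r :=
    ⟨r ^ (2⁻¹ : ℝ), by rw [← ENNReal.rpow_natCast, ← ENNReal.rpow_mul]; norm_num⟩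
  gcongr
  obtain rfl | hδ_top := eq_or_ne δ ∞
  · exact le_top
  have hδ : δ ≠ 0 := by rintro rfl; simp at hπr
  refine levyProkhorovEDist_le_of_isCoupling hπ ((ENNReal.mul_le_mul_iff_right hδ hδ_top).1 ?_)
  calc δ * π {z | δ ≤ edist z.1 z.2} ≤ ∫⁻ z, edist z.1 z.2 ∂π :=
        mul_meas_ge_le_lintegral measurable_edist δ
    _ = eLpNorm (fun z : E × E => edist z.1 z.2) 1 π := by
        rw [eLpNorm_one_eq_lintegral_enorm]; rfl
    _ ≤ eLpNorm (fun z : E × E => edist z.1 z.2) q π :=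
        eLpNorm_le_eLpNorm_of_exponent_le hq measurable_edist.aestronglyMeasurable
    _ ≤ δ * δ := by rw [← sq]; exact hπr.le

theorem eq_of_transportDist_eq_zero [MetricSpace E] [BorelSpace E] [SecondCountableTopology E]
    (hq : 1 ≤ q) {μ ν : Measure E} [IsProbabilityMeasure μ] [IsProbabilityMeasure ν]
    (h : transportDist edist q μ ν = 0) : μ = ν := by
  have h_sq := levyProkhorovEDist_sq_le_transportDist hq μ ν
  rw [h, nonpos_iff_eq_zero, pow_eq_zero_iff two_ne_zero] at h_sq
  let μ' : LevyProkhorov (ProbabilityMeasure E) := .ofMeasure ⟨μ, inferInstance⟩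
  let ν' : LevyProkhorov (ProbabilityMeasure E) := .ofMeasure ⟨ν, inferInstance⟩
  have h_dist : dist μ' ν' = 0 := by
    rw [LevyProkhorov.dist_probabilityMeasure_def, levyProkhorovDist]
    exact congrArg ENNReal.toReal h_sq
  exact congrArg (fun τ => (τ.toMeasure : Measure E)) (eq_of_dist_eq_zero h_dist)

end LevyProkhorov

/-- The `q`-Wasserstein space over `E`: the Borel probability measures on `E` with finite `q`-th
moment, equipped below with the optimal transport distance for the cost `‖x - y‖`. -/
@[ext]
structure WassersteinSpace (E : Type*) [NormedAddCommGroup E] [MeasurableSpace E] (q : ℝ≥0∞) where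
  toMeasure : Measure E
  isProbabilityMeasure : IsProbabilityMeasure toMeasure
  memLp_id : MemLp id q toMeasure

namespace WassersteinSpace

attribute [instance] isProbabilityMeasure

variable {E : Type*} [NormedAddCommGroup E] [MeasurableSpace E] {q : ℝ≥0∞}
  {Ω : Type*} [MeasurableSpace Ω] {P : Measure Ω}

theorem memLp_of_map_eq {X : Ω → E} (hX : AEMeasurable X P) {μ : WassersteinSpace E q}
    (h : P.map X = μ.toMeasure) : MemLp X q P :=
  MemLp.comp_of_map (g := id) (h ▸ μ.memLp_id) hX

variable [BorelSpace E] [SecondCountableTopology E]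

/-- The distribution of a random vector with finite `q`-th moment. -/
noncomputable def law [IsProbabilityMeasure P] (X : Lp E q P) : WassersteinSpace E q :=
  have hX : AEMeasurable X P := (Lp.aestronglyMeasurable X).aemeasurable
  { toMeasure := P.map X
    isProbabilityMeasure := Measure.isProbabilityMeasure_map hX
    memLp_id := (memLp_map_measure_iff aestronglyMeasurable_id hX).2 (Lp.memLp X) }

theorem law_toLp [IsProbabilityMeasure P] {X : Ω → E} (hX : MemLp X q P)
    {μ : WassersteinSpace E q} (h : P.map X = μ.toMeasure) : law (hX.toLp X) = μ :=
  WassersteinSpace.ext ((Measure.map_congr hX.coeFn_toLp).trans h)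

variable [CompleteSpace E]

theorem law_surjective :
    Function.Surjective (law : Lp E q (volume : Measure unitInterval) → WassersteinSpace E q) := by
  intro μ
  obtain ⟨X, hX, hX_law⟩ := Measure.exists_measurable_map_eq μ.toMeasure
  exact ⟨_, law_toLp (memLp_of_map_eq hX.aemeasurable hX_law) hX_law⟩

variable [hq : Fact (1 ≤ q)]

noncomputable instance : EMetricSpace (WassersteinSpace E q) where
  edist μ ν := transportDist edist q μ.toMeasure ν.toMeasure
  edist_self _ := transportDist_self measurable_edist edist_self _
  edist_comm _ _ := transportDist_comm measurable_edist edist_comm _ _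
  edist_triangle _ _ _ := transportDist_triangle measurable_edist measurable_edist
    measurable_edist edist_triangle hq.out _ _ _
  eq_of_edist_eq_zero h := WassersteinSpace.ext (eq_of_transportDist_eq_zero hq.out h)

theorem edist_def (μ ν : WassersteinSpace E q) :
    edist μ ν = transportDist edist q μ.toMeasure ν.toMeasure :=
  rfl

theorem lipschitzWith_law [IsProbabilityMeasure P] :
    LipschitzWith 1 (law : Lp E q P → WassersteinSpace E q) := by
  refine fun X Y => ?_
  rw [ENNReal.coe_one, one_mul]
  calc edist (law X) (law Y) ≤ eLpNorm (fun ω => edist (X ω) (Y ω)) q P :=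
        transportDist_map_le measurable_edist (Lp.aestronglyMeasurable X).aemeasurable
          (Lp.aestronglyMeasurable Y).aemeasurable
    _ = eLpNorm (fun ω => X ω - Y ω) q P :=
        eLpNorm_congr_enorm_ae <| ae_of_all _ fun ω => edist_eq_enorm_sub (X ω) (Y ω)
    _ = edist X Y := (Lp.edist_def X Y).symm

protected theorem edist_ne_top (μ ν : WassersteinSpace E q) : edist μ ν ≠ ∞ := by
  have h_prod := isCoupling_prod μ.toMeasure ν.toMeasure
  have hX := memLp_of_map_eq measurable_fst.aemeasurable h_prod.fst_eq
  have hY := memLp_of_map_eq measurable_snd.aemeasurable h_prod.snd_eq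
  have h_le := lipschitzWith_law.edist_le_mul (hX.toLp Prod.fst) (hY.toLp Prod.snd)
  rw [law_toLp hX h_prod.fst_eq, law_toLp hY h_prod.snd_eq] at h_le
  exact ne_top_of_le_ne_top (ENNReal.mul_ne_top ENNReal.coe_ne_top (edist_ne_top _ _)) h_le

theorem exists_law_eq_of_edist_lt {u : ℕ → WassersteinSpace E q} {b : ℕ → ℝ≥0∞}
    (h : ∀ n, edist (u n) (u (n + 1)) < b n) :
    ∃ (P : Measure (ℕ → E)) (_ : IsProbabilityMeasure P) (X : ℕ → Lp E q P),
      (∀ n, law (X n) = u n) ∧ ∀ n, edist (X n) (X (n + 1)) < b n := by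
  choose π hπ hπ_lt using fun n => exists_isCoupling_of_transportDist_lt (h n)
  have := fun n => (hπ n).isProbabilityMeasure
  obtain ⟨P, hP, hP_pair⟩ :=
    exists_measure_glue_seq π fun n => (hπ n).snd_eq.trans (hπ (n + 1)).fst_eq.symm
  have h_law (n : ℕ) : P.map (fun x => x n) = (u n).toMeasure := by
    rw [← (hπ n).fst_eq, ← hP_pair, Measure.fst_map_prodMk (by fun_prop)]
  have h_mem (n : ℕ) : MemLp (fun x : ℕ → E => x n) q P :=
    memLp_of_map_eq (measurable_pi_apply n).aemeasurable (h_law n)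
  refine ⟨P, hP, fun n => (h_mem n).toLp, fun n => law_toLp _ (h_law n), fun n => ?_⟩
  calc edist ((h_mem n).toLp) ((h_mem (n + 1)).toLp)
      = eLpNorm (fun x => edist (x n) (x (n + 1))) q P := by
        rw [Lp.edist_toLp_toLp]
        exact eLpNorm_congr_enorm_ae <| ae_of_all _ fun x => (edist_eq_enorm_sub _ _).symm
    _ = eLpNorm (fun z => edist z.1 z.2) q (π n) := by
        rw [← hP_pair, eLpNorm_map_measure measurable_edist.aestronglyMeasurable (by fun_prop)]
        rfl
    _ < b n := hπ_lt n

instance : CompleteSpace (WassersteinSpace E q) := by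
  let b (n : ℕ) : ℝ≥0∞ := 2⁻¹ ^ n
  have hb : ∑' n, b n ≠ ∞ := by simp [b, ENNReal.tsum_geometric]
  refine EMetric.complete_of_convergent_controlled_sequences b
    (fun n => ENNReal.pow_pos (by simp) n) fun u hu => ?_
  obtain ⟨P, _, X, hX, hXb⟩ := exists_law_eq_of_edist_lt fun n => hu n n (n + 1) le_rfl n.le_succ
  have hX_cauchy : CauchySeq X := cauchySeq_of_edist_le_of_tsum_ne_top b (fun n => (hXb n).le) hb
  obtain ⟨Y, hY⟩ := cauchySeq_tendsto_of_complete hX_cauchy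
  refine ⟨law Y, ?_⟩
  simpa only [Function.comp_def, hX] using (lipschitzWith_law.continuous.tendsto Y).comp hY

instance [Fact (q ≠ ∞)] : TopologicalSpace.SeparableSpace (WassersteinSpace E q) :=
  law_surjective.denseRange.separableSpace lipschitzWith_law.continuous

end WassersteinSpace

section LpDist

variable {p : ℝ} {n : ℕ}

theorem lpDist_nonneg (z z' : Fin n → ℝ) : 0 ≤ lpDist p z z' := by
  unfold lpDist; positivity

theorem lpDist_self (hp : p ≠ 0) (z : Fin n → ℝ) : lpDist p z z = 0 := by
  simp [lpDist, hp]

theorem lpDist_comm (z z' : Fin n → ℝ) : lpDist p z z' = lpDist p z' z := by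
  simp only [lpDist, abs_sub_comm]

theorem lpDist_triangle (hp : 1 ≤ p) (x y z : Fin n → ℝ) :
    lpDist p x z ≤ lpDist p x y + lpDist p y z := by
  simpa only [lpDist, sub_add_sub_cancel] using
    Real.Lp_add_le Finset.univ (fun i => x i - y i) (fun i => y i - z i) hp

theorem lpDist_rpow (hp : p ≠ 0) (z z' : Fin n → ℝ) :
    lpDist p z z' ^ p = ∑ i, |z i - z' i| ^ p := by
  rw [lpDist, one_div, Real.rpow_inv_rpow (by positivity) hp]

theorem dist_le_lpDist (hp : 0 < p) (z z' : Fin n → ℝ) : dist z z' ≤ lpDist p z z' := by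
  refine (dist_pi_le_iff (lpDist_nonneg _ _)).2 fun i => ?_
  rw [Real.dist_eq, ← Real.rpow_le_rpow_iff (abs_nonneg _) (lpDist_nonneg _ _) hp,
    lpDist_rpow hp.ne']
  exact Finset.single_le_sum (f := fun i => |z i - z' i| ^ p) (fun _ _ => by positivity)
    (Finset.mem_univ i)

theorem lpDist_le_mul_dist (hp : 0 < p) (z z' : Fin n → ℝ) :
    lpDist p z z' ≤ (n : ℝ) ^ (1 / p) * dist z z' := by
  rw [← Real.rpow_le_rpow_iff (lpDist_nonneg _ _) (by positivity) hp, lpDist_rpow hp.ne',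
    Real.mul_rpow (by positivity) dist_nonneg, one_div, Real.rpow_inv_rpow n.cast_nonneg hp.ne']
  calc ∑ i, |z i - z' i| ^ p ≤ ∑ _i : Fin n, dist z z' ^ p := by
        gcongr with i
        exact dist_le_pi_dist z z' i
    _ = n * dist z z' ^ p := by simp

end LpDist

section WeightedDist

variable {p w : ℝ} {d : ℕ}

theorem lpDist_rpow_eq_feature_add_time (hp : p ≠ 0) (z z' : Fin (d + 1) → ℝ) :
    lpDist p z z' ^ p = lpDist p (feature z) (feature z') ^ p + |time z - time z'| ^ p := by
  rw [lpDist_rpow hp, lpDist_rpow hp, Fin.sum_univ_castSucc]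
  rfl

theorem weightedDist_nonneg (hw : w ∈ Set.Icc (0 : ℝ) 1) (z z' : Fin (d + 1) → ℝ) :
    0 ≤ weightedDist p w z z' := by
  have := hw.1
  have := sub_nonneg.2 hw.2
  have := lpDist_nonneg (p := p) (feature z) (feature z')
  unfold weightedDist; positivity

theorem weightedDist_rpow (hp : p ≠ 0) (hw : w ∈ Set.Icc (0 : ℝ) 1) (z z' : Fin (d + 1) → ℝ) :
    weightedDist p w z z' ^ p =
      w * lpDist p (feature z) (feature z') ^ p + (1 - w) * |time z - time z'| ^ p := by
  have := hw.1
  have := sub_nonneg.2 hw.2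
  have := lpDist_nonneg (p := p) (feature z) (feature z')
  rw [weightedDist, one_div, Real.rpow_inv_rpow (by positivity) hp]

/-- The linear rescaling of `ℝ^{d+1}` that turns `d_{p,w}` into the `ℓ^p` distance. -/
noncomputable def rescale (p w : ℝ) (z : Fin (d + 1) → ℝ) : Fin (d + 1) → ℝ :=
  Fin.snoc (fun i => w ^ (1 / p) * feature z i) ((1 - w) ^ (1 / p) * time z)

theorem weightedDist_eq_lpDist_rescale (hp : p ≠ 0) (hw : w ∈ Set.Icc (0 : ℝ) 1)
    (z z' : Fin (d + 1) → ℝ) :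
    weightedDist p w z z' = lpDist p (rescale p w z) (rescale p w z') := by
  have h_scale {a : ℝ} (ha : 0 ≤ a) (x y : ℝ) :
      |a ^ (1 / p) * x - a ^ (1 / p) * y| ^ p = a * |x - y| ^ p := by
    rw [← mul_sub, abs_mul, abs_of_nonneg (by positivity), Real.mul_rpow (by positivity)
      (by positivity), one_div, Real.rpow_inv_rpow ha hp]
  rw [weightedDist, lpDist_rpow hp, lpDist, Fin.sum_univ_castSucc, Finset.mul_sum]
  simp only [rescale, Fin.snoc_castSucc, Fin.snoc_last, h_scale hw.1,
    h_scale (sub_nonneg.2 hw.2)]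

theorem weightedDist_self (hp : p ≠ 0) (hw : w ∈ Set.Icc (0 : ℝ) 1) (z : Fin (d + 1) → ℝ) :
    weightedDist p w z z = 0 := by
  rw [weightedDist_eq_lpDist_rescale hp hw, lpDist_self hp]

theorem weightedDist_comm (z z' : Fin (d + 1) → ℝ) :
    weightedDist p w z z' = weightedDist p w z' z := by
  simp only [weightedDist, lpDist_comm (feature z), abs_sub_comm (time z)]

theorem weightedDist_triangle (hp : 1 ≤ p) (hw : w ∈ Set.Icc (0 : ℝ) 1)
    (x y z : Fin (d + 1) → ℝ) :
    weightedDist p w x z ≤ weightedDist p w x y + weightedDist p w y z := by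
  have hp0 : p ≠ 0 := by positivity
  simp only [weightedDist_eq_lpDist_rescale hp0 hw]
  exact lpDist_triangle hp _ _ _

theorem measurable_weightedDist :
    Measurable fun z : (Fin (d + 1) → ℝ) × (Fin (d + 1) → ℝ) => weightedDist p w z.1 z.2 := by
  unfold weightedDist lpDist feature time
  fun_prop

theorem weightedDist_le_lpDist (hp : 0 < p) (hw : w ∈ Set.Icc (0 : ℝ) 1)
    (z z' : Fin (d + 1) → ℝ) : weightedDist p w z z' ≤ lpDist p z z' := by
  rw [← Real.rpow_le_rpow_iff (weightedDist_nonneg hw _ _) (lpDist_nonneg _ _) hp,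
    weightedDist_rpow hp.ne' hw, lpDist_rpow_eq_feature_add_time hp.ne']
  have h_feature := Real.rpow_nonneg (lpDist_nonneg (p := p) (feature z) (feature z')) p
  gcongr
  · exact mul_le_of_le_one_left h_feature hw.2
  · exact mul_le_of_le_one_left (by positivity) (sub_le_self _ hw.1)

theorem lpDist_eq_mul_weightedDist_half (hp : 0 < p) (z z' : Fin (d + 1) → ℝ) :
    lpDist p z z' = 2 ^ (1 / p) * weightedDist p (1 / 2) z z' := by
  have hw : (1 / 2 : ℝ) ∈ Set.Icc (0 : ℝ) 1 := by norm_num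
  have h_nonneg := weightedDist_nonneg (p := p) hw z z'
  rw [← Real.rpow_left_inj (lpDist_nonneg _ _) (by positivity) hp.ne',
    Real.mul_rpow (by positivity) h_nonneg, one_div, Real.rpow_inv_rpow zero_le_two hp.ne',
    weightedDist_rpow hp.ne' hw, lpDist_rpow_eq_feature_add_time hp.ne']
  ring

end WeightedDist

section Transfer

variable {p w : ℝ} {d : ℕ}

theorem lintegral_ofReal_rpow_rpow_eq_eLpNorm {Ω : Type*} [MeasurableSpace Ω] (hp : 0 < p)
    {f : Ω → ℝ} (hf : 0 ≤ f) (P : Measure Ω) :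
    (∫⁻ ω, ENNReal.ofReal (f ω ^ p) ∂P) ^ (1 / p) =
      eLpNorm (fun ω => ENNReal.ofReal (f ω)) (ENNReal.ofReal p) P := by
  rw [eLpNorm_eq_lintegral_rpow_enorm_toReal (ENNReal.ofReal_pos.2 hp).ne' ENNReal.ofReal_ne_top,
    ENNReal.toReal_ofReal hp.le]
  simp only [enorm_eq_self, ENNReal.ofReal_rpow_of_nonneg (hf _) hp.le]

theorem edist_le_ofReal_lpDist (hp : 0 < p) {n : ℕ} (z z' : Fin n → ℝ) :
    edist z z' ≤ ENNReal.ofReal (lpDist p z z') := by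
  rw [edist_dist]
  exact ENNReal.ofReal_le_ofReal (dist_le_lpDist hp z z')

theorem ofReal_lpDist_le_mul_edist (hp : 0 < p) {n : ℕ} (z z' : Fin n → ℝ) :
    ENNReal.ofReal (lpDist p z z') ≤ ((n : ℝ≥0) ^ (1 / p) : ℝ≥0) * edist z z' := by
  rw [edist_dist, ← ENNReal.ofReal_coe_nnreal, ← ENNReal.ofReal_mul NNReal.zero_le_coe]
  exact ENNReal.ofReal_le_ofReal (lpDist_le_mul_dist hp z z')

theorem lintegral_lpDist_rpow_lt_top_iff (hp : 0 < p) {n : ℕ} {μ : Measure (Fin n → ℝ)}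
    [IsFiniteMeasure μ] :
    (∀ z₀, ∫⁻ z, ENNReal.ofReal (lpDist p z₀ z ^ p) ∂μ < ∞) ↔ MemLp id (ENNReal.ofReal p) μ := by
  have h_iff (z₀ : Fin n → ℝ) : ∫⁻ z, ENNReal.ofReal (lpDist p z₀ z ^ p) ∂μ < ∞ ↔
      eLpNorm (fun z => ENNReal.ofReal (lpDist p z₀ z)) (ENNReal.ofReal p) μ < ∞ := by
    rw [← lintegral_ofReal_rpow_rpow_eq_eLpNorm hp (fun z => lpDist_nonneg z₀ z),
      ENNReal.rpow_lt_top_iff_of_pos (by positivity)]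
  simp only [h_iff]
  constructor
  · intro h
    refine ⟨aestronglyMeasurable_id, (eLpNorm_mono_enorm fun z => ?_).trans_lt (h 0)⟩
    simpa only [id_eq, enorm_eq_self, edist_zero_left, enorm_eq_nnnorm] using
      edist_le_ofReal_lpDist hp 0 z
  · intro h z₀
    have h_sub : MemLp (fun z => z₀ - z) (ENNReal.ofReal p) μ := (memLp_const z₀).sub h
    refine (eLpNorm_le_mul_eLpNorm_of_ae_le_mul' (c := (n : ℝ≥0) ^ (1 / p))
      (ae_of_all _ fun z => ?_) _).trans_lt (ENNReal.mul_lt_top ENNReal.coe_lt_top h_sub.2)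
    simpa only [enorm_eq_self, edist_eq_enorm_sub] using ofReal_lpDist_le_mul_edist hp z₀ z

theorem wasserstein_eq_transportDist (hp : 0 < p) (hw : w ∈ Set.Icc (0 : ℝ) 1) (α β : Pp d p) :
    wasserstein p w α β = transportDist (fun z z' => ENNReal.ofReal (weightedDist p w z z'))
      (ENNReal.ofReal p) (α.1 : Measure (Fin (d + 1) → ℝ)) β.1 := by
  have h_iInf := (ENNReal.orderIsoRpow (1 / p) (one_div_pos.2 hp)).map_iInf₂
    fun (π : ProbabilityMeasure ((Fin (d + 1) → ℝ) × (Fin (d + 1) → ℝ)))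
      (_ : π ∈ couplings α.1 β.1) =>
    ∫⁻ q, ENNReal.ofReal (weightedDist p w q.1 q.2 ^ p)
      ∂(π : Measure ((Fin (d + 1) → ℝ) × (Fin (d + 1) → ℝ)))
  simp only [ENNReal.orderIsoRpow_apply, lintegral_ofReal_rpow_rpow_eq_eLpNorm hp
    fun q : (Fin (d + 1) → ℝ) × (Fin (d + 1) → ℝ) => weightedDist_nonneg hw q.1 q.2] at h_iInf
  rw [wasserstein, h_iInf]
  apply le_antisymm
  · exact le_iInf₂ fun π hπ =>
      iInf₂_le (⟨π, hπ.isProbabilityMeasure⟩ : ProbabilityMeasure _) ⟨hπ.fst_eq, hπ.snd_eq⟩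
  · exact le_iInf₂ fun π hπ => transportDist_le_eLpNorm ⟨hπ.1, hπ.2⟩

theorem wasserstein_self (hp : 0 < p) (hw : w ∈ Set.Icc (0 : ℝ) 1) (α : Pp d p) :
    wasserstein p w α α = 0 := by
  rw [wasserstein_eq_transportDist hp hw]
  exact transportDist_self measurable_weightedDist.ennreal_ofReal
    (fun z => by rw [weightedDist_self hp.ne' hw, ENNReal.ofReal_zero]) _

theorem wasserstein_comm (hp : 0 < p) (hw : w ∈ Set.Icc (0 : ℝ) 1) (α β : Pp d p) :
    wasserstein p w α β = wasserstein p w β α := by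
  simp only [wasserstein_eq_transportDist hp hw]
  exact transportDist_comm measurable_weightedDist.ennreal_ofReal
    (fun z z' => by rw [weightedDist_comm]) _ _

theorem wasserstein_triangle (hp : 1 ≤ p) (hw : w ∈ Set.Icc (0 : ℝ) 1) (α β γ : Pp d p) :
    wasserstein p w α γ ≤ wasserstein p w α β + wasserstein p w β γ := by
  simp only [wasserstein_eq_transportDist (zero_lt_one.trans_le hp) hw]
  refine transportDist_triangle measurable_weightedDist.ennreal_ofReal
    measurable_weightedDist.ennreal_ofReal measurable_weightedDist.ennreal_ofReal
    (fun x y z => ?_) (ENNReal.one_le_ofReal.2 hp) _ _ _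
  rw [← ENNReal.ofReal_add (weightedDist_nonneg hw _ _) (weightedDist_nonneg hw _ _)]
  exact ENNReal.ofReal_le_ofReal (weightedDist_triangle hp hw x y z)

theorem wasserstein_le_tiotDist (hw : w ∈ Set.Icc (0 : ℝ) 1) (α β : Pp d p) :
    wasserstein p w α β ≤ tiotDist α β :=
  le_iSup₂ (f := fun w (_ : w ∈ Set.Icc (0 : ℝ) 1) => wasserstein p w α β) w hw

theorem tiotDist_self (hp : 0 < p) (α : Pp d p) : tiotDist α α = 0 :=
  nonpos_iff_eq_zero.1 <| iSup₂_le fun _ hw => (wasserstein_self hp hw α).le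

theorem tiotDist_comm (hp : 0 < p) (α β : Pp d p) : tiotDist α β = tiotDist β α :=
  biSup_congr fun _ hw => wasserstein_comm hp hw α β

theorem tiotDist_triangle (hp : 1 ≤ p) (α β γ : Pp d p) :
    tiotDist α γ ≤ tiotDist α β + tiotDist β γ :=
  iSup₂_le fun _ hw => (wasserstein_triangle hp hw α β γ).trans <|
    add_le_add (wasserstein_le_tiotDist hw α β) (wasserstein_le_tiotDist hw β γ)

instance [hp : Fact (1 ≤ p)] : Fact (1 ≤ ENNReal.ofReal p) := ⟨ENNReal.one_le_ofReal.2 hp.out⟩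

instance : Fact (ENNReal.ofReal p ≠ ∞) := ⟨ENNReal.ofReal_ne_top⟩

variable [hp : Fact (1 ≤ p)]

namespace Pp

/-- The `p`-Wasserstein space of the sup norm on `ℝ^{d+1}` has the same underlying set as
`P_p(ℝ^{d+1})`, because the sup norm and the `ℓ^p` norm are equivalent. -/
def equivWassersteinSpace : Pp d p ≃ WassersteinSpace (Fin (d + 1) → ℝ) (ENNReal.ofReal p) where
  toFun α := ⟨α.1, inferInstance,
    (lintegral_lpDist_rpow_lt_top_iff (zero_lt_one.trans_le hp.out)).1 α.2⟩
  invFun μ := ⟨⟨μ.toMeasure, μ.isProbabilityMeasure⟩,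
    (lintegral_lpDist_rpow_lt_top_iff (μ := μ.toMeasure) (zero_lt_one.trans_le hp.out)).2
      μ.memLp_id⟩
  left_inv _ := rfl
  right_inv _ := rfl

theorem edist_equivWassersteinSpace_le (α β : Pp d p) :
    edist (equivWassersteinSpace α) (equivWassersteinSpace β) ≤
      (2 ^ (1 / p) : ℝ≥0) * tiotDist α β := by
  have hp0 : 0 < p := zero_lt_one.trans_le hp.out
  have h_half : (1 / 2 : ℝ) ∈ Set.Icc (0 : ℝ) 1 := by norm_num
  have h_cost (z z' : Fin (d + 1) → ℝ) :
      edist z z' ≤ (2 ^ (1 / p) : ℝ≥0) * ENNReal.ofReal (weightedDist p (1 / 2) z z') := by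
    rw [← ENNReal.ofReal_coe_nnreal, ← ENNReal.ofReal_mul NNReal.zero_le_coe, NNReal.coe_rpow,
      NNReal.coe_ofNat, ← lpDist_eq_mul_weightedDist_half hp0]
    exact edist_le_ofReal_lpDist hp0 z z'
  calc edist (equivWassersteinSpace α) (equivWassersteinSpace β)
      ≤ (2 ^ (1 / p) : ℝ≥0) * wasserstein p (1 / 2) α β := by
        rw [wasserstein_eq_transportDist hp0 h_half, WassersteinSpace.edist_def]
        exact transportDist_le_mul (by positivity) h_cost _ _
    _ ≤ (2 ^ (1 / p) : ℝ≥0) * tiotDist α β := by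
        gcongr
        exact wasserstein_le_tiotDist h_half α β

theorem tiotDist_le_mul_edist (α β : Pp d p) :
    tiotDist α β ≤ (((d + 1 : ℕ) : ℝ≥0) ^ (1 / p) : ℝ≥0) *
      edist (equivWassersteinSpace α) (equivWassersteinSpace β) := by
  have hp0 : 0 < p := zero_lt_one.trans_le hp.out
  refine iSup₂_le fun w hw => ?_
  rw [wasserstein_eq_transportDist hp0 hw]
  refine transportDist_le_mul (NNReal.rpow_pos (Nat.cast_pos.2 d.succ_pos)).ne'
    (fun z z' => ?_) _ _
  exact (ENNReal.ofReal_le_ofReal (weightedDist_le_lpDist hp0 hw z z')).trans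
    (ofReal_lpDist_le_mul_edist hp0 z z')

theorem tiotDist_ne_top (α β : Pp d p) : tiotDist α β ≠ ∞ :=
  ne_top_of_le_ne_top
    (ENNReal.mul_ne_top ENNReal.coe_ne_top (WassersteinSpace.edist_ne_top _ _))
    (tiotDist_le_mul_edist α β)

theorem eq_of_tiotDist_eq_zero {α β : Pp d p} (h : tiotDist α β = 0) : α = β := by
  have h_le := edist_equivWassersteinSpace_le α β
  rw [h, mul_zero, nonpos_iff_eq_zero, edist_eq_zero] at h_le
  exact equivWassersteinSpace.injective h_le

noncomputable instance : EMetricSpace (Pp d p) where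
  edist := tiotDist
  edist_self := tiotDist_self (zero_lt_one.trans_le hp.out)
  edist_comm := tiotDist_comm (zero_lt_one.trans_le hp.out)
  edist_triangle := tiotDist_triangle hp.out
  eq_of_edist_eq_zero := eq_of_tiotDist_eq_zero

/-- `𝒟_p` and the Wasserstein distance of the sup norm are Lipschitz equivalent, so they induce
the same uniform structure. -/
noncomputable def uniformEquivWassersteinSpace :
    Pp d p ≃ᵤ WassersteinSpace (Fin (d + 1) → ℝ) (ENNReal.ofReal p) :=
  equivWassersteinSpace.toUniformEquivOfIsUniformInducing <|
    AntilipschitzWith.isUniformInducing (tiotDist_le_mul_edist (d := d) (p := p))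
      (LipschitzWith.uniformContinuous (edist_equivWassersteinSpace_le (d := d) (p := p)))

instance : CompleteSpace (Pp d p) :=
  uniformEquivWassersteinSpace.completeSpace_iff.2 inferInstance

instance : TopologicalSpace.SeparableSpace (Pp d p) :=
  uniformEquivWassersteinSpace.symm.surjective.denseRange.separableSpace
    uniformEquivWassersteinSpace.symm.continuous

end Pp

end Transfer

end TiOT

theorem mainTheorem4 (d : ℕ) (p : ℝ) (hp : 1 ≤ p) :
    (∀ α β : TiOT.Pp d p, TiOT.tiotDist α β ≠ ⊤) ∧
    ∃ m : MetricSpace (TiOT.Pp d p),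
      (∀ α β : TiOT.Pp d p, m.dist α β = (TiOT.tiotDist α β).toReal) ∧
      @CompleteSpace (TiOT.Pp d p) m.toPseudoMetricSpace.toUniformSpace ∧
      @TopologicalSpace.SeparableSpace (TiOT.Pp d p)
        m.toPseudoMetricSpace.toUniformSpace.toTopologicalSpace := by
  have : Fact (1 ≤ p) := ⟨hp⟩
  exact ⟨TiOT.Pp.tiotDist_ne_top, EMetricSpace.toMetricSpace TiOT.Pp.tiotDist_ne_top,
    fun _ _ => rfl, inferInstance, inferInstance⟩
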